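/- Let $\Bbbk$ be a field. A finitary 2-category over $\Bbbk$ is a (strict) 2-category $\mathscr{C}$ with finitely many objects such that: each category $\mathscr{C}(\mathtt{i},\mathtt{j})$ is $\Bbbk$-linear, additive and idempotent split, with finite-dimensional morphism spaces and finitely many isomorphism classes of indecomposable objects; horizontal composition is $\Bbbk$-bilinear; and each identity 1-morphism $\mathbb{1}_{\mathtt{i}}$ is indecomposable. It is called fiat if it has a weak involution $\star$ (a weak 2-functor $\mathscr{C}\to\mathscr{C}$ that is the identity on objects, reverses the direction of 1-morphisms and of 2-morphisms, and satisfies $F^{\star\star}\cong F$ naturally in $F$) such that, for every 1-morphism $F:\mathtt{i}\to\mathtt{j}$, the pair $(F,F^\star)$ is adjoint via 2-morphisms $FF^\star\to\mathbb{1}_{\mathtt{j}}$ and $\mathbb{1}_{\mathtt{i}}\to F^\star F$ satisfying the triangle identities. For indecomposable 1-morphisms $F,G$ starting at an object $\mathtt{i}$, write $F\leq_L G$ if $G$ is isomorphic to a direct summand of $H\circ F$ for some 1-morphism $H$. The equivalence classes of the induced equivalence relation are the left cells. Let $\mathscr{C}$ be a fiat 2-category, $\mathcal{L}$ a left cell in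 $\mathscr{C}$, and $\mathtt{i}$ the object at which all 1-morphisms of $\mathcal{L}$ start. A 1-morphism $G:\mathtt{i}\to\mathtt{i}$ is good for $\mathcal{L}$ via a 2-morphism $\varphi:G\to\mathbb{1}_{\mathtt{i}}$ if $F\varphi:FG\to F$ is right split for every $F\in\mathcal{L}$, i.e. there is $\xi:F\to FG$ with $F\varphi\circ_v\xi=\mathrm{id}_F$. It is great for $\mathcal{L}$ if it is good via some $\varphi$ such that, for every 1-morphism $G'$ that is good for $\mathcal{L}$ via some $\varphi':G'\to\mathbb{1}_{\mathtt{i}}$, there is a 2-morphism $\beta:G\to G'$ with $\varphi=\varphi'\circ_v\beta$. For each object $\mathtt{j}$, let $\overline{\mathbf{P}}_{\mathtt{i}}(\mathtt{j})$ be the projective abelianization of $\mathscr{C}(\mathtt{i},\mathtt{j})$: its objects are diagrams $X\to Y$ in $\mathscr{C}(\mathtt{i},\mathtt{j})$, and its morphisms are commutative squares modulo those whose component $Y\to Y'$ factors through $X'\to Y'$. A 1-morphism $F:\mathtt{j}\to\mathtt{k}$ acts by $(X\to Y)\mapsto(FX\to FY)$, and $P_G$ denotes the object $0\to G$. A 1-morphism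 $G\in\mathcal{L}$ with $G:\mathtt{i}\to\mathtt{i}$ is a Duflo 1-morphism of $\mathcal{L}$ if $P_{\mathbb{1}_{\mathtt{i}}}$ has a subobject $K$ in $\overline{\mathbf{P}}_{\mathtt{i}}(\mathtt{i})$ such that $F(P_{\mathbb{1}_{\mathtt{i}}}/K)=0$ for all $F\in\mathcal{L}$ and there is an epimorphism $P_G\to K$. Proposition. Let $G:\mathtt{i}\to\mathtt{i}$ be a 1-morphism in $\mathcal{L}$. Then $G$ is great for $\mathcal{L}$ if and only if $G$ is the Duflo 1-morphism of $\mathcal{L}$, that is, if and only if $G$ is a Duflo 1-morphism of $\mathcal{L}$ and every Duflo 1-morphism of $\mathcal{L}$ is isomorphic to $G$. -/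

import Mathlib

open CategoryTheory CategoryTheory.Limits CategoryTheory.Bicategory

universe w v u t

namespace TwoCat

/-! Conventions: `F ≫ H` is the horizontal composite "first `F`, then `H`", i.e. `H ∘ F` in the
functional notation. `Bicategory.Strict` bicategories are 2-categories. -/

section Finitary

variable (C : Type u) [Bicategory.{w, v} C] [∀ a b : C, Preadditive (a ⟶ b)]

/-- The categories of 1-morphisms are additive, and horizontal composition of 2-morphisms is
biadditive. -/
class IsAdditive : Prop where
  hasFiniteBiproducts (a b : C) : HasFiniteBiproducts (a ⟶ b)
  whiskerLeft_add {a b c : C} (F : a ⟶ b) {G H : b ⟶ c} (η θ : G ⟶ H) :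
    F ◁ (η + θ) = F ◁ η + F ◁ θ
  add_whiskerRight {a b c : C} {F G : a ⟶ b} (η θ : F ⟶ G) (H : b ⟶ c) :
    (η + θ) ▷ H = η ▷ H + θ ▷ H

instance [IsAdditive C] (a b : C) : HasFiniteBiproducts (a ⟶ b) :=
  IsAdditive.hasFiniteBiproducts a b

instance [IsAdditive C] (a b : C) : HasBinaryBiproducts (a ⟶ b) :=
  HasBinaryBiproducts.of_hasBinaryProducts

instance [IsAdditive C] (a b : C) : HasZeroObject (a ⟶ b) :=
  hasZeroObject_of_hasFiniteBiproducts _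

/-- A finitary 2-category over the field `k`: a strict 2-category with finitely many objects, whose
categories of 1-morphisms are `k`-linear, additive, idempotent split, with finite dimensional spaces
of 2-morphisms and finitely many isomorphism classes of indecomposable objects, whose
horizontal composition is `k`-bilinear, and whose identity 1-morphisms are indecomposable. -/
structure IsFinitary (k : Type t) [Field k] [∀ a b : C, Linear k (a ⟶ b)] [IsAdditive C] :
    Prop where
  strict : Bicategory.Strict C
  finite_objects : Finite C
  whiskerLeft_smul {a b c : C} (F : a ⟶ b) {G H : b ⟶ c} (r : k) (η : G ⟶ H) :
    F ◁ (r • η) = r • (F ◁ η)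
  smul_whiskerRight {a b c : C} {F G : a ⟶ b} (r : k) (η : F ⟶ G) (H : b ⟶ c) :
    (r • η) ▷ H = r • (η ▷ H)
  isIdempotentComplete (a b : C) : IsIdempotentComplete (a ⟶ b)
  finiteDimensional {a b : C} (F G : a ⟶ b) : FiniteDimensional k (F ⟶ G)
  finite_indecomposables (a b : C) : ∃ s : Finset (a ⟶ b),
    ∀ F : a ⟶ b, Indecomposable F → ∃ G ∈ s, Nonempty (F ≅ G)
  indecomposable_id (a : C) : Indecomposable (𝟙 a)

end Finitary

section Fiat

/-- A weak involution: a weak (pseudofunctorial) 2-functor from `C` to itself which is the identity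
on objects, reverses the directions of both 1-morphisms and 2-morphisms, and whose square is
isomorphic to the identity, naturally on each category of 1-morphisms. -/
structure WeakInvolution (C : Type u) [Bicategory.{w, v} C] where
  star {a b : C} (F : a ⟶ b) : b ⟶ a
  star₂ {a b : C} {F G : a ⟶ b} (η : F ⟶ G) : star G ⟶ star F
  star₂_id {a b : C} (F : a ⟶ b) : star₂ (𝟙 F) = 𝟙 (star F)
  star₂_comp {a b : C} {F G H : a ⟶ b} (η : F ⟶ G) (θ : G ⟶ H) :
    star₂ (η ≫ θ) = star₂ θ ≫ star₂ η
  starId (a : C) : star (𝟙 a) ≅ 𝟙 a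
  starComp {a b c : C} (F : a ⟶ b) (G : b ⟶ c) : star (F ≫ G) ≅ star G ≫ star F
  star₂_whiskerLeft {a b c : C} (F : a ⟶ b) {G H : b ⟶ c} (η : G ⟶ H) :
    star₂ (F ◁ η) = (starComp F H).hom ≫ star₂ η ▷ star F ≫ (starComp F G).inv
  star₂_whiskerRight {a b c : C} {F G : a ⟶ b} (η : F ⟶ G) (H : b ⟶ c) :
    star₂ (η ▷ H) = (starComp G H).hom ≫ star H ◁ star₂ η ≫ (starComp F H).inv
  star₂_associator {a b c d : C} (F : a ⟶ b) (G : b ⟶ c) (H : c ⟶ d) :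
    star₂ (α_ F G H).hom = (starComp F (G ≫ H)).hom ≫ (starComp G H).hom ▷ star F ≫
      (α_ (star H) (star G) (star F)).hom ≫ star H ◁ (starComp F G).inv ≫
        (starComp (F ≫ G) H).inv
  star₂_leftUnitor {a b : C} (F : a ⟶ b) :
    star₂ (λ_ F).hom =
      (ρ_ (star F)).inv ≫ star F ◁ (starId a).inv ≫ (starComp (𝟙 a) F).inv
  star₂_rightUnitor {a b : C} (F : a ⟶ b) :
    star₂ (ρ_ F).hom =
      (λ_ (star F)).inv ≫ (starId b).inv ▷ star F ≫ (starComp F (𝟙 b)).inv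
  starStar {a b : C} (F : a ⟶ b) : star (star F) ≅ F
  starStar_naturality {a b : C} {F G : a ⟶ b} (η : F ⟶ G) :
    star₂ (star₂ η) ≫ (starStar G).hom = (starStar F).hom ≫ η

/-- A fiat 2-category: a finitary 2-category with a weak involution `⋆` such that each `(F, F⋆)` is
an adjoint pair, i.e. there are 2-morphisms `F ∘ F⋆ ⟶ 𝟙` and `𝟙 ⟶ F⋆ ∘ F` satisfying
the triangle identities. -/
structure IsFiat (k : Type t) [Field k] (C : Type u) [Bicategory.{w, v} C]
    [∀ a b : C, Preadditive (a ⟶ b)] [∀ a b : C, Linear k (a ⟶ b)] [IsAdditive C] :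
    Prop where
  finitary : IsFinitary C k
  exists_involution : ∃ S : WeakInvolution C,
    ∀ {a b : C} (F : a ⟶ b), Nonempty (Bicategory.Adjunction F (S.star F))

end Fiat

section Abelianization

variable {V W : Type*} [Category* V] [Preadditive V] [Category* W] [Preadditive W]

/-- The extension of an additive functor `Φ` to the projective abelianizations: a diagram `X ⟶ Y`
is sent to `Φ X ⟶ Φ Y`. -/
noncomputable def freydMap (Φ : V ⥤ W) [Φ.Additive] :
    Preadditive.RightFreyd V ⥤ Preadditive.RightFreyd W :=
  CategoryTheory.Quotient.lift _ (Φ.mapArrow ⋙ Preadditive.RightFreyd.quotient W) (by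
    rintro x y f g ⟨h⟩
    refine Preadditive.RightFreyd.eq_of_rightHomotopy _ _ ⟨Φ.map h.hom, ?_⟩
    have key : Φ.map f.right - Φ.map g.right = Φ.map h.hom ≫ Φ.map y.hom := by
      rw [← Φ.map_sub, h.comm, Φ.map_comp]
    exact key)

end Abelianization

section Cells

variable {C : Type u} [Bicategory.{w, v} C]

/-- The left preorder on 1-morphisms starting at `i`: `F ≤ G` if `G` is a direct summand of `H ∘ F`
for some `H`. (Direct summands are retracts, as idempotents split.) -/
def LeftLE {i j l : C} (F : i ⟶ j) (G : i ⟶ l) : Prop :=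
  ∃ H : j ⟶ l, Nonempty (Retract G (F ≫ H))

variable [∀ a b : C, Preadditive (a ⟶ b)] [IsAdditive C]

/-- `L` is a left cell of 1-morphisms starting at `i`: the set of all indecomposable 1-morphisms
which are left equivalent to some given indecomposable 1-morphism. -/
def IsLeftCell {i : C} (L : Set (Σ j : C, i ⟶ j)) : Prop :=
  ∃ F : Σ j : C, i ⟶ j, Indecomposable F.2 ∧
    L = {G | Indecomposable G.2 ∧ LeftLE F.2 G.2 ∧ LeftLE G.2 F.2}

end Cells

section Great

variable {C : Type u} [Bicategory.{w, v} C]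

/-- `F φ : F ∘ G ⟶ F` is right split for all `F ∈ L`. -/
def IsGoodMor {i : C} (L : Set (Σ j : C, i ⟶ j)) {G : i ⟶ i} (φ : G ⟶ 𝟙 i) : Prop :=
  ∀ F ∈ L, ∃ ξ : F.2 ⟶ G ≫ F.2, ξ ≫ φ ▷ F.2 ≫ (λ_ F.2).hom = 𝟙 F.2

/-- `G` is great for `L`: it is good for `L` through some `φ : G ⟶ 𝟙 i`, and this `φ` factors
through every `φ' : G' ⟶ 𝟙 i` through which some 1-morphism `G'` is good for `L`. -/
def IsGreat {i : C} (L : Set (Σ j : C, i ⟶ j)) (G : i ⟶ i) : Prop :=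
  ∃ φ : G ⟶ 𝟙 i, IsGoodMor L φ ∧
    ∀ (G' : i ⟶ i) (φ' : G' ⟶ 𝟙 i), IsGoodMor L φ' → ∃ β : G ⟶ G', β ≫ φ' = φ

end Great

section Duflo

variable {C : Type u} [Bicategory.{w, v} C] [∀ a b : C, Preadditive (a ⟶ b)] [IsAdditive C]

instance {i j l : C} (F : j ⟶ l) : (postcomp i F).Additive where
  map_add {_ _ η θ} := IsAdditive.add_whiskerRight η θ F

/-- The value at `j` of the projective abelianization of the principal 2-representation
`C(i, -)`: objects are diagrams `X ⟶ Y` in `C(i, j)`, morphisms are commutative squares modulo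
those whose component on `Y` factors through the target diagram. -/
abbrev AbPrincipal (i j : C) := Preadditive.RightFreyd (i ⟶ j)

/-- The action of a 1-morphism `F` on the abelianized principal 2-representation. -/
noncomputable abbrev act (i : C) {j l : C} (F : j ⟶ l) : AbPrincipal i j ⥤ AbPrincipal i l :=
  freydMap (postcomp i F)

/-- The projective object `P_G`, given by the diagram `0 ⟶ G`. -/
noncomputable abbrev proj {i j : C} (G : i ⟶ j) : AbPrincipal i j :=
  (Preadditive.RightFreyd.functor (i ⟶ j)).obj G

/-- `G ∈ L` is a Duflo 1-morphism for `L`: the projective `P_{𝟙 i}` has a subobject `K` such that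
`P_{𝟙 i} / K` is annihilated by all `F ∈ L` and there is an epimorphism `P_G ⟶ K`. -/
def IsDuflo {i : C} (L : Set (Σ j : C, i ⟶ j)) (G : i ⟶ i) : Prop :=
  (⟨i, G⟩ : Σ j : C, i ⟶ j) ∈ L ∧
    ∃ K : Subobject (proj (𝟙 i)),
      (∀ F ∈ L, IsZero ((act i F.2).obj (cokernel K.arrow))) ∧
      ∃ p : proj G ⟶ (K : AbPrincipal i i), Epi p

end Duflo

end TwoCat

/-! For `G` in the cell, great and Duflo both amount to good. If `φ'` is good, a section of `φ'`
whiskered with `G`, together with the interchange law, factors every `φ : G ⟶ 𝟙 i` through `φ'`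
(`IsGoodMor.factors`); so good implies great. An additive functor kills the cokernel of `P_φ`
exactly when it makes `φ` split epi (`isZero_freydMap_cokernel_iff`), so `φ` is good iff the image
of `P_φ` can serve as the subobject `K`; this image exists because `C(i, i)` has weak kernels
(`exists_weakKernel`). Uniqueness: good maps from two members of the cell are nonzero and factor
through each other, so Fitting's lemma makes their sources isomorphic. -/

/-! ### Fitting dichotomy in finite dimensional algebras -/

section FiniteAlgebra

/-- In a finite dimensional algebra without nontrivial idempotents, every element is invertible or
nilpotent. -/
theorem isUnit_or_isNilpotent_of_forall_isIdempotentElem (k : Type*) {A : Type*} [Field k] [Ring A]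
    [Algebra k A] [Module.Finite k A] (h : ∀ e : A, IsIdempotentElem e → e = 0 ∨ e = 1) (x : A) :
    IsUnit x ∨ IsNilpotent x := by
  have := Algebra.isMulCommutative_adjoin k (s := {x}) fun a ha b hb => by
    rw [Set.mem_singleton_iff.1 ha, Set.mem_singleton_iff.1 hb]
  have : IsArtinianRing (Algebra.adjoin k {x}) :=
    isArtinian_of_tower k (inferInstance : IsArtinian k (Algebra.adjoin k {x}))
  let X : Algebra.adjoin k {x} := ⟨x, Algebra.self_mem_adjoin_singleton k x⟩
  -- The powers of `X` generate a descending chain of ideals, which stabilises.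
  obtain ⟨n, y, hy⟩ := IsArtinian.exists_pow_succ_smul_dvd X (1 : Algebra.adjoin k {x})
  have hy : X ^ n = X ^ n * (X * y) := by
    simp only [smul_eq_mul, mul_one] at hy
    rw [← mul_assoc, ← pow_succ, hy]
  have hm : ∀ m, X ^ n = X ^ n * (X * y) ^ m := fun m => by
    induction m with
    | zero => simp
    | succ m ih => rw [pow_succ, ← mul_assoc, ← ih, ← hy]
  -- The exponent `n + 1` makes this a multiple of `X ^ n`, and of `X` even when `n = 0`.
  have he : IsIdempotentElem ((X * y) ^ (n + 1)) := by
    change (X * y) ^ (n + 1) * (X * y) ^ (n + 1) = (X * y) ^ (n + 1)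
    calc (X * y) ^ (n + 1) * (X * y) ^ (n + 1)
        = (X ^ n * (X * y) ^ (n + 1)) * (X * y ^ (n + 1)) := by ring
      _ = (X * y) ^ (n + 1) := by rw [← hm]; ring
  have hA : IsIdempotentElem (((X * y) ^ (n + 1) : Algebra.adjoin k {x}) : A) :=
    congrArg Subtype.val he
  rcases h _ hA with h0 | h1
  · right
    have h0 : (X * y) ^ (n + 1) = 0 := Subtype.ext h0
    exact ⟨n, congrArg Subtype.val ((hm (n + 1)).trans (by rw [h0, mul_zero]))⟩
  · left
    have h1 : (X * y) ^ (n + 1) = 1 := Subtype.ext h1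
    have hX : IsUnit X := isUnit_of_mul_isUnit_left ((isUnit_pow_succ_iff).1 (h1 ▸ isUnit_one))
    exact hX.map (Algebra.adjoin k {x}).val

end FiniteAlgebra

/-! ### Indecomposable objects and weak kernels -/

namespace CategoryTheory

variable {V : Type*} [Category* V] [Preadditive V] [HasBinaryBiproducts V]

/-- An indecomposable object of an idempotent complete category has no nontrivial idempotent
endomorphisms. -/
theorem Indecomposable.eq_zero_or_eq_id [IsIdempotentComplete V] {X : V} (hX : Indecomposable X)
    (e : X ⟶ X) (he : e ≫ e = e) : e = 0 ∨ e = 𝟙 X := by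
  obtain ⟨Y, i, p, hip, hpi⟩ := IsIdempotentComplete.idempotents_split X e he
  obtain ⟨Z, j, q, hjq, hqj⟩ := IsIdempotentComplete.idempotents_split X (𝟙 X - e) (by simp [he])
  have hiq : i ≫ q = 0 := by
    have : i ≫ q ≫ j = 0 := by
      rw [hqj, ← hpi, Preadditive.comp_sub, Category.comp_id, reassoc_of% hip, sub_self]
    calc i ≫ q = (i ≫ q ≫ j) ≫ q := by simp [hjq]
      _ = 0 := by rw [this, zero_comp]
  have hjp : j ≫ p = 0 := by
    have : j ≫ p ≫ i = 0 := by
      have hj : j ≫ (𝟙 X - e) = j := by rw [← hqj, reassoc_of% hjq]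
      rw [Preadditive.comp_sub, Category.comp_id, sub_eq_self] at hj
      rw [hpi, hj]
    calc j ≫ p = (j ≫ p ≫ i) ≫ p := by simp [hip]
      _ = 0 := by rw [this, zero_comp]
  have iso : X ≅ Y ⊞ Z :=
    { hom := biprod.lift p q
      inv := biprod.desc i j
      hom_inv_id := by simp [hpi, hqj]
      inv_hom_id := by ext <;> simp [hip, hjq, hiq, hjp] }
  rcases hX.2 Y Z iso with h | h
  · left
    rw [← hpi, h.eq_of_tgt p 0, zero_comp]
  · right
    rw [h.eq_of_tgt q 0, zero_comp] at hqj
    exact (sub_eq_zero.1 hqj.symm).symm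

variable (k : Type*) [Field k] [Linear k V]

/-- Fitting's lemma for indecomposable objects. -/
theorem Indecomposable.isIso_of_comp_eq [IsIdempotentComplete V] {X Y : V}
    (hX : Indecomposable X) [FiniteDimensional k (X ⟶ X)] {f : X ⟶ Y} (hf : f ≠ 0) {e : X ⟶ X}
    (he : e ≫ f = f) : IsIso e := by
  have : Module.Finite k (End X) := inferInstanceAs (Module.Finite k (X ⟶ X))
  rcases isUnit_or_isNilpotent_of_forall_isIdempotentElem k (A := End X)
    (fun e he => hX.eq_zero_or_eq_id e he) e with h | ⟨n, hn⟩
  · exact (isUnit_iff_isIso e).1 h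
  · refine absurd ?_ hf
    let e' : End X := e
    -- Every power of `e` fixes `f`, so nilpotency would force `f = 0`.
    have hpow : ∀ m : ℕ, (show X ⟶ X from e' ^ m) ≫ f = f := fun m => by
      induction m with
      | zero => exact Category.id_comp f
      | succ m ih =>
        change (e ≫ (show X ⟶ X from e' ^ m)) ≫ f = f
        rw [Category.assoc, ih, he]
    have hn' : (show X ⟶ X from e' ^ n) = 0 := hn
    rw [← hpow n, hn', zero_comp]

/-- Two indecomposable objects with nonzero maps to a common object which factor through each other
are isomorphic. -/
theorem Indecomposable.nonempty_iso_of_factors [IsIdempotentComplete V] {X Y Z : V}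
    (hX : Indecomposable X) (hY : Indecomposable Y) [FiniteDimensional k (X ⟶ X)]
    [FiniteDimensional k (Y ⟶ Y)] {f : X ⟶ Z} {g : Y ⟶ Z} (hf : f ≠ 0) (hg : g ≠ 0)
    {a : X ⟶ Y} {b : Y ⟶ X} (ha : a ≫ g = f) (hb : b ≫ f = g) : Nonempty (X ≅ Y) := by
  have hab : IsIso (a ≫ b) := hX.isIso_of_comp_eq k hf (by rw [Category.assoc, hb, ha])
  have hba : IsIso (b ≫ a) := hY.isIso_of_comp_eq k hg (by rw [Category.assoc, ha, hb])
  have : IsSplitMono a := ⟨⟨⟨b ≫ inv (a ≫ b), by rw [← Category.assoc, IsIso.hom_inv_id]⟩⟩⟩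
  have : IsSplitEpi a := ⟨⟨⟨inv (b ≫ a) ≫ b, by rw [Category.assoc, IsIso.inv_hom_id]⟩⟩⟩
  have : IsIso a := isIso_of_mono_of_isSplitEpi a
  exact ⟨asIso a⟩

/-- Block-diagonal endomorphisms embed in `X ⟶ X`. Nonzero summands thus have strictly smaller
endomorphism spaces, which lets induction on this dimension replace a Krull–Schmidt decomposition.
-/
theorem finrank_end_add_le {X Y Z : V} (iso : X ≅ Y ⊞ Z) [FiniteDimensional k (X ⟶ X)]
    [FiniteDimensional k (Y ⟶ Y)] [FiniteDimensional k (Z ⟶ Z)] :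
    Module.finrank k (Y ⟶ Y) + Module.finrank k (Z ⟶ Z) ≤ Module.finrank k (X ⟶ X) := by
  let ψ : ((Y ⟶ Y) × (Z ⟶ Z)) →ₗ[k] (X ⟶ X) :=
    { toFun ab := iso.hom ≫ biprod.map ab.1 ab.2 ≫ iso.inv
      map_add' a b := by
        rw [← Preadditive.comp_add, ← Preadditive.add_comp]
        congr 2
        ext <;> simp
      map_smul' r a := by
        rw [RingHom.id_apply, ← Linear.comp_smul, ← Linear.smul_comp]
        congr 2
        ext <;> simp }
  rw [← Module.finrank_prod]
  refine LinearMap.finrank_le_finrank_of_injective (f := ψ) fun a b hab => ?_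
  have hab : iso.hom ≫ biprod.map a.1 a.2 ≫ iso.inv = iso.hom ≫ biprod.map b.1 b.2 ≫ iso.inv := hab
  have hab : biprod.map a.1 a.2 = biprod.map b.1 b.2 := by simpa using hab
  refine Prod.ext ?_ ?_
  · simpa using congrArg (fun f => biprod.inl ≫ f ≫ biprod.fst) hab
  · simpa using congrArg (fun f => biprod.inr ≫ f ≫ biprod.snd) hab

/-- Induction on decompositions into indecomposable objects. -/
theorem induction_of_indecomposable [∀ X : V, FiniteDimensional k (X ⟶ X)] {P : V → Prop}
    (zero : ∀ X, IsZero X → P X) (indec : ∀ X, Indecomposable X → P X)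
    (sum : ∀ X Y Z, (X ≅ Y ⊞ Z) → P Y → P Z → P X) (X : V) : P X := by
  induction hn : Module.finrank k (X ⟶ X) using Nat.strong_induction_on generalizing X with
  | _ n ih =>
  by_cases hX : IsZero X
  · exact zero X hX
  by_cases hI : Indecomposable X
  · exact indec X hI
  obtain ⟨Y, Z, iso, hY, hZ⟩ : ∃ Y Z, ∃ _ : X ≅ Y ⊞ Z, ¬IsZero Y ∧ ¬IsZero Z := by
    by_contra h
    refine hI ⟨hX, fun Y Z iso => ?_⟩
    by_contra h'
    exact h ⟨Y, Z, iso, not_or.1 h'⟩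
  have hlt := finrank_end_add_le k iso
  have pos : ∀ {U : V}, ¬IsZero U → 0 < Module.finrank k (U ⟶ U) := fun {U} hU =>
    have : Nontrivial (U ⟶ U) := ⟨⟨𝟙 U, 0, fun h => hU ((IsZero.iff_id_eq_zero U).2 h)⟩⟩
    Module.finrank_pos
  have := pos hY
  have := pos hZ
  exact sum X Y Z iso (ih _ (by omega) Y rfl) (ih _ (by omega) Z rfl)

/-- In a category of finite type, weak kernels exist. -/
theorem exists_weakKernel [HasFiniteBiproducts V] [∀ X Y : V, FiniteDimensional k (X ⟶ Y)]
    (hfin : ∃ s : Finset V, ∀ X : V, Indecomposable X → ∃ M ∈ s, Nonempty (X ≅ M))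
    {G Z : V} (φ : G ⟶ Z) :
    ∃ (W : V) (κ : W ⟶ G), κ ≫ φ = 0 ∧
      ∀ (X : V) (f : X ⟶ G), f ≫ φ = 0 → ∃ g : X ⟶ W, g ≫ κ = f := by
  obtain ⟨s, hs⟩ := hfin
  let N (M : V) : Submodule k (M ⟶ G) := LinearMap.ker (Linear.rightComp k M φ)
  -- The weak kernel takes one copy of each representative `M` for every basis vector of the space
  -- of maps `M ⟶ G` killed by `φ`.
  let ι := Σ M : s, Fin (Module.finrank k (N M.1))
  let b (x : ι) : x.1.1 ⟶ G := (Module.finBasis k (N x.1.1) x.2).1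
  refine ⟨⨁ fun x : ι => x.1.1, biproduct.desc b, ?_, fun X => ?_⟩
  · ext x
    rw [biproduct.ι_desc_assoc, comp_zero]
    exact (Module.finBasis k (N x.1.1) x.2).2
  refine induction_of_indecomposable k (P := fun X => ∀ f : X ⟶ G, f ≫ φ = 0 →
    ∃ g : X ⟶ ⨁ fun x : ι => x.1.1, g ≫ biproduct.desc b = f) ?_ ?_ ?_ X
  · exact fun X hX f _ => ⟨0, hX.eq_of_src _ _⟩
  · intro X hX f hf
    obtain ⟨M, hM, ⟨iso⟩⟩ := hs X hX
    have hmem : iso.inv ≫ f ∈ N M := by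
      change (iso.inv ≫ f) ≫ φ = 0
      rw [Category.assoc, hf, comp_zero]
    let c := (Module.finBasis k (N M)).repr ⟨iso.inv ≫ f, hmem⟩
    refine ⟨iso.hom ≫ ∑ m, c m • biproduct.ι (fun x : ι => x.1.1) ⟨⟨M, hM⟩, m⟩, ?_⟩
    have := congrArg Subtype.val ((Module.finBasis k (N M)).sum_repr ⟨iso.inv ≫ f, hmem⟩)
    simp only [Submodule.coe_sum, Submodule.coe_smul] at this
    rw [Category.assoc, Preadditive.sum_comp, ← Iso.eq_inv_comp, ← this]
    refine Finset.sum_congr rfl fun m _ => ?_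
    rw [Linear.smul_comp, biproduct.ι_desc]
  · intro X Y Z iso hY hZ f hf
    obtain ⟨g, hg⟩ := hY (biprod.inl ≫ iso.inv ≫ f) (by simp [hf])
    obtain ⟨h, hh⟩ := hZ (biprod.inr ≫ iso.inv ≫ f) (by simp [hf])
    refine ⟨iso.hom ≫ biprod.desc g h, ?_⟩
    rw [Category.assoc, ← Iso.eq_inv_comp]
    ext <;> simp [hg, hh]

end CategoryTheory

/-! ### Cokernels and images in the projective abelianization -/

section Freyd

open Preadditive

variable {V W : Type*} [Category* V] [Preadditive V] [Category* W] [Preadditive W]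

/-- A null-homotopy of the identity is precisely a section of `f`. -/
theorem isZero_quotient_obj_iff {X Y : V} (f : X ⟶ Y) :
    IsZero ((RightFreyd.quotient V).obj (Arrow.mk f)) ↔ ∃ s : Y ⟶ X, s ≫ f = 𝟙 Y := by
  rw [IsZero.iff_id_eq_zero, ← CategoryTheory.Functor.map_id, RightFreyd.quotient_map_eq_zero_iff]
  constructor
  · rintro ⟨h⟩
    refine ⟨h.hom, ?_⟩
    have : 𝟙 Y - 0 = h.hom ≫ f := h.comm
    rw [← this, sub_zero]
  · rintro ⟨s, hs⟩
    refine ⟨⟨s, ?_⟩⟩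
    change 𝟙 Y - 0 = s ≫ f
    rw [hs, sub_zero]

variable [HasZeroObject V]

open ZeroObject in
/-- The cokernel of `P_φ` is annihilated by an additive functor `Φ` exactly if `Φ φ` is
split. -/
theorem isZero_freydMap_cokernel_iff [HasBinaryBiproducts V] (Φ : V ⥤ W) [Φ.Additive]
    {G X : V} (φ : G ⟶ X) :
    IsZero ((TwoCat.freydMap Φ).obj (cokernel ((RightFreyd.functor V).map φ))) ↔
      ∃ s : Φ.obj X ⟶ Φ.obj G, s ≫ Φ.map φ = 𝟙 _ := by
  -- The diagram `c` is the explicit cokernel of `P_φ`; its summand `0` does not affect splitting.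
  let c : (0 : V) ⊞ G ⟶ X := biprod.desc 0 φ
  let e : cokernel ((RightFreyd.functor V).map φ) ≅ (RightFreyd.quotient V).obj (Arrow.mk c) :=
    (cokernelIsCokernel _).coconePointUniqueUpToIso
      (RightFreyd.Candidate.isColimitCokernelCofork ((RightFreyd.rightFunctor V).map φ))
  rw [((TwoCat.freydMap Φ).mapIso e).isZero_iff]
  refine (isZero_quotient_obj_iff (Φ.map c)).trans ?_
  have hc : c = biprod.snd ≫ φ := by
    ext
    simp [c]
  constructor
  · rintro ⟨s, hs⟩
    exact ⟨s ≫ Φ.map biprod.snd, by rw [Category.assoc, ← Φ.map_comp, ← hc, hs]⟩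
  · rintro ⟨s, hs⟩
    refine ⟨s ≫ Φ.map biprod.inr, ?_⟩
    rw [Category.assoc, ← Φ.map_comp, hc, biprod.inr_snd_assoc, hs]

/-- If `φ` has a weak kernel, then `P_φ` factors as an epimorphism followed by a monomorphism. -/
theorem exists_epi_mono_factorisation {G X Y : V} (φ : G ⟶ X) (κ : Y ⟶ G) (hκ : κ ≫ φ = 0)
    (h : ∀ (U : V) (f : U ⟶ G), f ≫ φ = 0 → ∃ g : U ⟶ Y, g ≫ κ = f) :
    ∃ (K : RightFreyd V) (p : (RightFreyd.functor V).obj G ⟶ K)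
      (m : K ⟶ (RightFreyd.functor V).obj X), Epi p ∧ Mono m ∧
        p ≫ m = (RightFreyd.functor V).map φ := by
  -- The image is represented by the weak kernel diagram `κ : Y ⟶ G` itself.
  let p : (RightFreyd.rightFunctor V).obj G ⟶ Arrow.mk κ := Arrow.homMk 0 (𝟙 G)
    (zero_comp.trans zero_comp.symm)
  let m : Arrow.mk κ ⟶ (RightFreyd.rightFunctor V).obj X := Arrow.homMk 0 φ
    (zero_comp.trans hκ.symm)
  refine ⟨_, (RightFreyd.quotient V).map p, (RightFreyd.quotient V).map m, ?_, ?_, ?_⟩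
  · have : IsIso p.right := inferInstanceAs (IsIso (𝟙 G))
    exact RightFreyd.epi_of_isIso_right p
  · refine Preadditive.mono_of_cancel_zero _ fun {u} g hg => ?_
    obtain ⟨u, rfl⟩ := (show ∃ u', (RightFreyd.quotient V).obj u' = u from
      ⟨u.as, rfl⟩)
    obtain ⟨g, rfl⟩ := (RightFreyd.quotient V).map_surjective g
    rw [← Functor.map_comp, RightFreyd.quotient_map_eq_zero_iff] at hg
    rw [RightFreyd.quotient_map_eq_zero_iff]
    obtain ⟨H⟩ := hg
    -- The target diagram starts at `0`, so homotopic to zero means `g.right ≫ φ = 0`; the lift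
    -- through `κ` is then a null-homotopy of `g`.
    have hH : g.right ≫ φ - 0 = H.hom ≫ 0 := H.comm
    obtain ⟨a, ha⟩ := h _ g.right (by simpa using hH)
    refine ⟨⟨a, ?_⟩⟩
    change g.right - 0 = a ≫ κ
    rw [ha, sub_zero]
  · rw [← Functor.map_comp]
    refine congrArg (RightFreyd.quotient V).map ?_
    ext
    · exact zero_comp
    · exact Category.id_comp φ

end Freyd

/-! ### Good, great and Duflo 1-morphisms -/

namespace TwoCat

variable {C : Type u} [Bicategory.{w, v} C]

/-- Every 2-morphism `φ : G ⟶ 𝟙 i` with `G ∈ L` factors through every good `φ' : G' ⟶ 𝟙 i`. -/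
theorem IsGoodMor.factors {i : C} {L : Set (Σ j : C, i ⟶ j)} {G G' : i ⟶ i}
    (hG : (⟨i, G⟩ : Σ j : C, i ⟶ j) ∈ L) (φ : G ⟶ 𝟙 i) {φ' : G' ⟶ 𝟙 i} (h' : IsGoodMor L φ') :
    ∃ β : G ⟶ G', β ≫ φ' = φ := by
  obtain ⟨τ, hτ⟩ := h' _ hG
  -- Interchange lets `φ'` act before `φ`, where it cancels against its section `τ`.
  refine ⟨τ ≫ G' ◁ φ ≫ (ρ_ G').hom, ?_⟩
  calc (τ ≫ G' ◁ φ ≫ (ρ_ G').hom) ≫ φ'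
      = τ ≫ (G' ◁ φ ≫ φ' ▷ 𝟙 i) ≫ (ρ_ (𝟙 i)).hom := by simp
    _ = τ ≫ (φ' ▷ G ≫ 𝟙 i ◁ φ) ≫ (λ_ (𝟙 i)).hom := by
        rw [whisker_exchange, unitors_equal]
    _ = (τ ≫ φ' ▷ G ≫ (λ_ G).hom) ≫ φ := by simp
    _ = φ := by rw [hτ, Category.id_comp]

/-- A 1-morphism in `L` is great as soon as it is good. -/
theorem isGreat_iff_exists_isGoodMor {i : C} {L : Set (Σ j : C, i ⟶ j)} {G : i ⟶ i}
    (hG : (⟨i, G⟩ : Σ j : C, i ⟶ j) ∈ L) : IsGreat L G ↔ ∃ φ : G ⟶ 𝟙 i, IsGoodMor L φ :=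
  ⟨fun ⟨φ, h, _⟩ => ⟨φ, h⟩, fun ⟨φ, h⟩ => ⟨φ, h, fun _ _ h' => h'.factors hG φ⟩⟩

/-- Absorbing the unitor turns the splitting into one of the image of `φ` under `postcomp`. -/
theorem exists_section_leftUnitor_iff {i j : C} {G : i ⟶ i} (φ : G ⟶ 𝟙 i) (F : i ⟶ j) :
    (∃ ξ : F ⟶ G ≫ F, ξ ≫ φ ▷ F ≫ (λ_ F).hom = 𝟙 F) ↔
      ∃ s : 𝟙 i ≫ F ⟶ G ≫ F, s ≫ φ ▷ F = 𝟙 _ := by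
  constructor
  · rintro ⟨ξ, h⟩
    refine ⟨(λ_ F).hom ≫ ξ, ?_⟩
    rw [← cancel_mono (λ_ F).hom]
    simp [h]
  · rintro ⟨s, h⟩
    exact ⟨(λ_ F).inv ≫ s, by simp [reassoc_of% h]⟩

variable [∀ a b : C, Preadditive (a ⟶ b)] [IsAdditive C]

theorem isGoodMor_iff_isZero_cokernel {i : C} {L : Set (Σ j : C, i ⟶ j)} {G : i ⟶ i}
    (φ : G ⟶ 𝟙 i) : IsGoodMor L φ ↔ ∀ F ∈ L, IsZero ((act i F.2).obj
      (cokernel ((Preadditive.RightFreyd.functor (i ⟶ i)).map φ))) :=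
  forall₂_congr fun F _ => (exists_section_leftUnitor_iff φ F.2).trans
    (isZero_freydMap_cokernel_iff (postcomp i F.2) φ).symm

/-- Since `proj` comes from a full functor, the composite `P_G ⟶ K ⟶ P_{𝟙 i}` is some `P_φ`;
precomposing with an epimorphism does not change the cokernel. -/
theorem IsDuflo.exists_isGoodMor {i : C} {L : Set (Σ j : C, i ⟶ j)} {G : i ⟶ i}
    (h : IsDuflo L G) : ∃ φ : G ⟶ 𝟙 i, IsGoodMor L φ := by
  obtain ⟨-, K, hK, p, hp⟩ := h
  obtain ⟨φ, hφ⟩ := (Preadditive.RightFreyd.functor (i ⟶ i)).map_surjective (p ≫ K.arrow)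
  refine ⟨φ, (isGoodMor_iff_isZero_cokernel φ).2 fun F hF => ?_⟩
  rw [hφ]
  exact (hK F hF).of_iso ((act i F.2).mapIso (cokernelEpiComp p K.arrow))

/-- The image of `P_φ` serves as `K`, as the inclusion has the same cokernel as `P_φ`. -/
theorem IsGoodMor.isDuflo {k : Type t} [Field k] [∀ a b : C, Linear k (a ⟶ b)]
    (hC : IsFinitary C k) {i : C} {L : Set (Σ j : C, i ⟶ j)} {G : i ⟶ i}
    (hG : (⟨i, G⟩ : Σ j : C, i ⟶ j) ∈ L) {φ : G ⟶ 𝟙 i} (h : IsGoodMor L φ) : IsDuflo L G := by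
  have : ∀ X Y : i ⟶ i, FiniteDimensional k (X ⟶ Y) := fun X Y => hC.finiteDimensional X Y
  obtain ⟨W, κ, hκ, hW⟩ := exists_weakKernel k (hC.finite_indecomposables i i) φ
  obtain ⟨K, p, m, hp, hm, hpm⟩ := exists_epi_mono_factorisation φ κ hκ hW
  refine ⟨hG, Subobject.mk m, fun F hF => ?_, p ≫ (Subobject.underlyingIso m).inv, epi_comp _ _⟩
  have := (isGoodMor_iff_isZero_cokernel φ).1 h F hF
  refine this.of_iso ((act i F.2).mapIso ?_)
  exact (cokernelEpiComp (p ≫ (Subobject.underlyingIso m).inv) _).symm ≪≫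
    cokernelIsoOfEq (by rw [Category.assoc, Subobject.underlyingIso_arrow, hpm])

/-- A 1-morphism in `L` is a Duflo 1-morphism exactly if it is good. -/
theorem isDuflo_iff_exists_isGoodMor {k : Type t} [Field k] [∀ a b : C, Linear k (a ⟶ b)]
    (hC : IsFinitary C k) {i : C} {L : Set (Σ j : C, i ⟶ j)} {G : i ⟶ i}
    (hG : (⟨i, G⟩ : Σ j : C, i ⟶ j) ∈ L) : IsDuflo L G ↔ ∃ φ : G ⟶ 𝟙 i, IsGoodMor L φ :=
  ⟨fun h => h.exists_isGoodMor, fun ⟨_, h⟩ => h.isDuflo hC hG⟩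

theorem IsLeftCell.indecomposable {i : C} {L : Set (Σ j : C, i ⟶ j)} (hL : IsLeftCell L)
    {F : Σ j : C, i ⟶ j} (hF : F ∈ L) : Indecomposable F.2 := by
  obtain ⟨F₀, -, rfl⟩ := hL
  exact hF.1

/-- If `φ` were zero, the splitting would give `𝟙 F = 0`. Fitting's lemma needs this nonvanishing.
-/
theorem IsGoodMor.ne_zero {i : C} {L : Set (Σ j : C, i ⟶ j)} {F : Σ j : C, i ⟶ j} (hF : F ∈ L)
    (hF₀ : ¬IsZero F.2) {G : i ⟶ i} {φ : G ⟶ 𝟙 i} (h : IsGoodMor L φ) : φ ≠ 0 := by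
  rintro rfl
  obtain ⟨ξ, hξ⟩ := h F hF
  refine hF₀ ((IsZero.iff_id_eq_zero _).2 ?_)
  have : (0 : G ⟶ 𝟙 i) ▷ F.2 = 0 := (postcomp i F.2).map_zero G (𝟙 i)
  rw [← hξ, this, zero_comp, comp_zero]

/-- Any two good 1-morphisms in a left cell are isomorphic. -/
theorem IsLeftCell.nonempty_iso_of_isGoodMor {k : Type t} [Field k]
    [∀ a b : C, Linear k (a ⟶ b)] (hC : IsFinitary C k) {i : C} {L : Set (Σ j : C, i ⟶ j)}
    (hL : IsLeftCell L) {G G' : i ⟶ i} (hG : (⟨i, G⟩ : Σ j : C, i ⟶ j) ∈ L)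
    (hG' : (⟨i, G'⟩ : Σ j : C, i ⟶ j) ∈ L) {φ : G ⟶ 𝟙 i} {φ' : G' ⟶ 𝟙 i} (h : IsGoodMor L φ)
    (h' : IsGoodMor L φ') : Nonempty (G' ≅ G) := by
  have : ∀ X Y : i ⟶ i, FiniteDimensional k (X ⟶ Y) := fun X Y => hC.finiteDimensional X Y
  have := hC.isIdempotentComplete i i
  have hI : Indecomposable G := hL.indecomposable hG
  have hI' : Indecomposable G' := hL.indecomposable hG'
  obtain ⟨a, ha⟩ := h.factors hG' φ'
  obtain ⟨b, hb⟩ := h'.factors hG φ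
  exact hI'.nonempty_iso_of_factors k hI (h'.ne_zero hG hI.1) (h.ne_zero hG hI.1) ha hb

end TwoCat

theorem mainTheorem4 {k : Type t} [Field k] {C : Type u} [Bicategory.{w, v} C]
    [∀ a b : C, Preadditive (a ⟶ b)] [∀ a b : C, Linear k (a ⟶ b)] [TwoCat.IsAdditive C]
    (hC : TwoCat.IsFiat k C) (i : C) (L : Set (Σ j : C, i ⟶ j)) (hL : TwoCat.IsLeftCell L)
    (G : i ⟶ i) (hG : (⟨i, G⟩ : Σ j : C, i ⟶ j) ∈ L) :
    TwoCat.IsGreat L G ↔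
      (TwoCat.IsDuflo L G ∧ ∀ G' : i ⟶ i, TwoCat.IsDuflo L G' → Nonempty (G' ≅ G)) := by
  rw [TwoCat.isGreat_iff_exists_isGoodMor hG, TwoCat.isDuflo_iff_exists_isGoodMor hC.finitary hG]
  refine ⟨fun h => ⟨h, fun G' h' => ?_⟩, fun h => h.1⟩
  obtain ⟨φ, hφ⟩ := h
  obtain ⟨φ', hφ'⟩ := h'.exists_isGoodMor
  exact hL.nonempty_iso_of_isGoodMor hC.finitary hG h'.1 hφ hφ'
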